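/- **Theorem (Regret reduction from offline expert data).** Consider a Bayesian bandit with a finite non-empty action set $\mathcal A$, a parameter space $\Theta$ (a standard Borel space, e.g. a countable set), an outcome space $\mathcal Y$, outcome distributions $p_{\theta,a}$ on $\mathcal Y$ depending measurably on $\theta$, and a measurable reward function $R:\mathcal Y\to\mathbb R$. Let $\mu(a,\theta)=\mathbb E_{Y\sim p_{\theta,a}}[R(Y)]$ and let $a^*:\Theta\to\mathcal A$ be measurable with $a^*(\theta)\in\arg\max_{a}\mu(a,\theta)$ for all $\theta$. Assume that the mean rewards are bounded, $\sup_{\theta,a}|\mu(a,\theta)|<\infty$, and that the reward noise is uniformly sub-Gaussian: for some $v\ge 0$, $\mathbb E_{Y\sim p_{\theta,a}}[e^{\lambda(R(Y)-\mu(a,\theta))}]\le e^{v\lambda^2/2}$ for all $\lambda\in\mathbb R$, $\theta$, $a$ (both hold, in particular, if $R$ is bounded). Then there is a constant $C$, depending only on this bandit problem (not on the prior, $N$ or $T$), such that the following holds for every prior $P_0$ on $\Theta$ and all $N,T\in\mathbb N$. Let $\theta^*\sim P_0$, $A^*=a^*(\theta^*)$, and, given $\theta^*$, let the expert data $D_N^*=(Y_1^*,\dots,Y_N^*)$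 be i.i.d. from $p_{\theta^*,a^*(\theta^*)}$. Let the learner run Thompson Sampling with the prior replaced by the posterior $P_1(\theta)=P(\theta\mid D_N^*)$: in each round $t$, given the past, it samples $\hat\theta_t$, independently of $\theta^*$, from the posterior of $\theta^*$ given $D_N^*$ and its own history $\mathcal H_t=(A_s,Y_s)_{s<t}$, plays $A_t=a^*(\hat\theta_t)$ and observes $Y_t\sim p_{\theta^*,A_t}$. Let $\mathrm{Reg}(T)=\sum_{t=1}^T \big(R(\bar Y_t)-R(Y_t)\big)$, where $\bar Y_t$, given $\theta^*$, has law $p_{\theta^*,a^*(\theta^*)}$. Then $\mathrm{Reg}(T)$ is integrable and its expectation, over all sources of randomness including $D_N^*$, satisfies $$\mathbb E[\mathrm{Reg}(T)]\le C\sqrt{T\,\big(\mathbb H_0(A^*)-\mathbb I_0(A^*;D_N^*)\big)},$$ where $\mathbb H_0(A^*)=-\sum_{a}P(A^*=a)\log P(A^*=a)$ is the prior entropy of the optimal action, $\mathbb I_0(A^*;D_N^*)=\mathbb H_0(A^*)-\mathbb H_0(A^*\mid D_N^*)$ is the mutual information between the optimal action and the expert data, and $\mathbb H_0(A^*\mid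 D_N^*)=\mathbb E[-\log P(A^*\mid D_N^*)]$. Moreover $0\le \mathbb I_0(A^*;D_N^*)\le\mathbb H_0(A^*)$, so that this bound is never larger than $C\sqrt{T\,\mathbb H_0(A^*)}$. -/

import Mathlib

open MeasureTheory ProbabilityTheory
open scoped NNReal

noncomputable section

/-! ### Information-theoretic quantities (natural logarithm) -/

/-- Shannon entropy `H(X) = -∑ₓ p(x) log p(x)` of a random variable with finitely many values. -/
def entropy {Ω S : Type*} [MeasurableSpace Ω] [Fintype S] (X : Ω → S) (P : Measure Ω) : ℝ :=
  -∑ x : S, P.real (X ⁻¹' {x}) * Real.log (P.real (X ⁻¹' {x}))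

/-- Conditional entropy `H(X | Z) = E[-log p(X | Z)]`, where `p(x | z)` is the conditional
probability of `X = x` given `Z = z`. -/
def condEntropy {Ω S 𝓩 : Type*} [MeasurableSpace Ω] [Fintype S] [Nonempty S]
    [MeasurableSpace S] [DiscreteMeasurableSpace S] [MeasurableSpace 𝓩]
    (X : Ω → S) (Z : Ω → 𝓩) (P : Measure Ω) [IsFiniteMeasure P] : ℝ :=
  ∫ ω, -Real.log ((condDistrib X Z P (Z ω)).real {X ω}) ∂P

/-- Mutual information `I(X; Z) = H(X) - H(X | Z)`. -/
def mutualInfo {Ω S 𝓩 : Type*} [MeasurableSpace Ω] [Fintype S] [Nonempty S]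
    [MeasurableSpace S] [DiscreteMeasurableSpace S] [MeasurableSpace 𝓩]
    (X : Ω → S) (Z : Ω → 𝓩) (P : Measure Ω) [IsFiniteMeasure P] : ℝ :=
  entropy X P - condEntropy X Z P

/-! ### Bandits -/

section Bandit

variable {Θ 𝓐 𝓨 : Type*} [MeasurableSpace Θ] [MeasurableSpace 𝓐] [MeasurableSpace 𝓨]

/-- The mean reward `μ(a, θ) = E_{Y ∼ p_{θ,a}}[R(Y)]`. -/
def meanReward (p : Kernel (Θ × 𝓐) 𝓨) (R : 𝓨 → ℝ) (a : 𝓐) (θ : Θ) : ℝ :=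
  ∫ y, R y ∂(p (θ, a))

/-- The outcome distribution `p_{θ, a*(θ)}` of the optimal action, as a kernel in `θ`. -/
def optKernel (p : Kernel (Θ × 𝓐) 𝓨) (aStar : Θ → 𝓐) (hA : Measurable aStar) : Kernel Θ 𝓨 :=
  p.comap (fun θ => (θ, aStar θ)) (measurable_id.prodMk hA)

instance (p : Kernel (Θ × 𝓐) 𝓨) [IsMarkovKernel p] (aStar : Θ → 𝓐) (hA : Measurable aStar) :
    IsMarkovKernel (optKernel p aStar hA) := by
  unfold optKernel; infer_instance

/-- The law of `N` independent draws from `κ θ`, as a kernel in `θ`. -/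
def iidKernel (κ : Kernel Θ 𝓨) [IsMarkovKernel κ] (N : ℕ) : Kernel Θ (Fin N → 𝓨) where
  toFun θ := Measure.pi fun _ => κ θ
  measurable' := by
    refine Measurable.measure_of_isPiSystem_of_isProbabilityMeasure generateFrom_pi.symm
      isPiSystem_pi ?_
    rintro _ ⟨s, hs, rfl⟩
    simp only [Measure.pi_pi]
    exact Finset.measurable_prod _ fun i _ => κ.measurable_coe (hs i (Set.mem_univ i))

instance (κ : Kernel Θ 𝓨) [IsMarkovKernel κ] (N : ℕ) : IsMarkovKernel (iidKernel κ N) :=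
  ⟨fun θ => by
    change IsProbabilityMeasure (Measure.pi fun _ : Fin N => κ θ)
    infer_instance⟩

variable {Ω : Type*} [MeasurableSpace Ω]

/-- The history of the action-outcome pairs of the learner in the first `t` rounds
(rounds are numbered from `0`). -/
def history (A : ℕ → Ω → 𝓐) (Y : ℕ → Ω → 𝓨) (t : ℕ) (ω : Ω) : Fin t → 𝓐 × 𝓨 :=
  fun s => (A s ω, Y s ω)

/-- The belief of the learner at round `t`: the posterior distribution of the parameter given the
expert data and the history of the first `t` rounds. For `t = 0` the history is trivial and this
is the expert-updated prior `P(θ | D)`. -/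
def belief [StandardBorelSpace Θ] [Nonempty Θ] {N : ℕ} (P : Measure Ω) [IsFiniteMeasure P]
    (θs : Ω → Θ) (D : Ω → Fin N → 𝓨) (A : ℕ → Ω → 𝓐) (Y : ℕ → Ω → 𝓨) (t : ℕ) :
    Kernel ((Fin N → 𝓨) × (Fin t → 𝓐 × 𝓨)) Θ :=
  condDistrib θs (fun ω => (D ω, history A Y t ω)) P

/-- The current belief as the law of the sampled parameter given the true parameter, the expert data
and the history; it does not depend on the true parameter. -/
def sampleKernel [StandardBorelSpace Θ] [Nonempty Θ] {N : ℕ} (P : Measure Ω) [IsFiniteMeasure P]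
    (θs : Ω → Θ) (D : Ω → Fin N → 𝓨) (A : ℕ → Ω → 𝓐) (Y : ℕ → Ω → 𝓨) (t : ℕ) :
    Kernel (Θ × (Fin N → 𝓨) × (Fin t → 𝓐 × 𝓨)) Θ :=
  (belief P θs D A Y t).comap (fun x => x.2) measurable_snd

/-- The law `p_{θ, a}` of the outcome given the true parameter `θ`, the expert data, the history and
the current action `a`; it does not depend on the expert data and the history. -/
def outcomeKernel (p : Kernel (Θ × 𝓐) 𝓨) (N t : ℕ) :
    Kernel (Θ × (Fin N → 𝓨) × (Fin t → 𝓐 × 𝓨) × 𝓐) 𝓨 :=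
  p.comap (fun x => (x.1, x.2.2.2)) (by fun_prop)

/-- The random variables on `(Ω, P)` describe Thompson sampling, warm-started with `N` expert
outcomes, in the Bayesian bandit with outcome distributions `p` and prior `P₀`:
* `θs` is the true parameter and `D` the expert dataset;
* `θhat t`, `A t`, `Y t` are the parameter sampled by the learner, its action and the outcome it
  observes in round `t`;
* `Ystar t` is an outcome of the optimal action in round `t` (its dependence on the other variables,
  beyond the true parameter, is left open). -/
structure IsExpertThompsonSampling [StandardBorelSpace Θ] [Nonempty Θ]
    (p : Kernel (Θ × 𝓐) 𝓨) [IsMarkovKernel p] (aStar : Θ → 𝓐) (hA : Measurable aStar)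
    (P₀ : Measure Θ) (N : ℕ) (P : Measure Ω) [IsFiniteMeasure P]
    (θs : Ω → Θ) (D : Ω → Fin N → 𝓨) (θhat : ℕ → Ω → Θ) (A : ℕ → Ω → 𝓐)
    (Y Ystar : ℕ → Ω → 𝓨) : Prop where
  /-- The true parameter is drawn from the prior. -/
  param_law : HasLaw θs P₀ P
  /-- Given the parameter, the expert outcomes are i.i.d. with law `p_{θ, a*(θ)}`. -/
  expert_law : HasCondDistrib D θs (iidKernel (optKernel p aStar hA) N) P
  /-- Given the parameter, the expert data and the history, the sampled parameter is drawn from the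
  current belief (which depends on the expert data and the history only). -/
  sample_law : ∀ t, HasCondDistrib (θhat t) (fun ω => (θs ω, D ω, history A Y t ω))
    (sampleKernel P θs D A Y t) P
  /-- The learner plays the action that is optimal for the sampled parameter. -/
  action_eq : ∀ t ω, A t ω = aStar (θhat t ω)
  /-- Given the parameter, the past and the current action `a`, the outcome has law `p_{θ, a}`. -/
  outcome_law : ∀ t, HasCondDistrib (Y t) (fun ω => (θs ω, D ω, history A Y t ω, A t ω))
    (outcomeKernel p N t) P
  /-- Given the parameter, the optimal outcome has law `p_{θ, a*(θ)}`. -/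
  optimal_law : ∀ t, HasCondDistrib (Ystar t) θs (optKernel p aStar hA) P

/-- The regret `Reg(T) = ∑_t (R(Y_t*) - R(Y_t))` over the first `T` rounds. -/
def regret (R : 𝓨 → ℝ) (Y Ystar : ℕ → Ω → 𝓨) (T : ℕ) (ω : Ω) : ℝ :=
  ∑ t ∈ Finset.range T, (R (Ystar t ω) - R (Y t ω))

end Bandit

end

/- Given the data seen so far, the action played has the same law as the optimal action but is
independent of the true parameter, so the mean regret of a round is a sum over the actions `a` of
gaps, the covariances of the mean reward of `a` with the event that `a` is optimal. Tilting the law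
of the optimal action by the exponential of a multiple of the observed reward deviation gives a
sub-probability prediction after the round, because that deviation is sub-Gaussian with proxy
`c = v + B ^ 2` (noise, and Hoeffding's lemma for the mean rewards). By Gibbs' inequality the
conditional entropy of the optimal action then drops by at least `∑ gap ^ 2 / (2 * c)`. Hence
`η * gap ≤ gap ^ 2 / (2 * c) + η ^ 2 * c / 2` bounds `η` times the regret of a round by the drop
plus `card 𝓐 * η ^ 2 * c / 2`; the drops telescope to at most `H(A* | D)`, and optimising over `η`
gives the square root. -/

section CondDistrib

variable {Ω 𝓧 𝓤 𝓥 : Type*} [MeasurableSpace Ω] [MeasurableSpace 𝓧] [MeasurableSpace 𝓤]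
  [MeasurableSpace 𝓥] {P : Measure Ω} {X : Ω → 𝓧} {U : Ω → 𝓤} {V : Ω → 𝓥} {κ : Kernel 𝓧 𝓤}

lemma hasCondDistrib_condDistrib [IsFiniteMeasure P] [StandardBorelSpace 𝓤] [Nonempty 𝓤]
    (hX : AEMeasurable X P) (hU : AEMeasurable U P) :
    HasCondDistrib U X (condDistrib U X P) P :=
  ⟨hX.prodMk hU, (compProd_map_condDistrib hU).symm⟩

lemma hasCondDistrib_prodMk {η : Kernel (𝓧 × 𝓤) 𝓥} (hU : HasCondDistrib U X κ P)
    (hV : HasCondDistrib V (fun ω => (X ω, U ω)) η P) :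
    HasCondDistrib (fun ω => (U ω, V ω)) X (κ ⊗ₖ η) P where
  aemeasurable := hU.aemeasurable_fst.prodMk (hU.aemeasurable_snd.prodMk hV.aemeasurable_snd)
  map_eq := by
    rw [← Measure.compProd_assoc', ← hU.map_eq, ← hV.map_eq,
      AEMeasurable.map_map_of_aemeasurable (by fun_prop) hV.aemeasurable]
    rfl

lemma lintegral_of_hasCondDistrib [SFinite P] [IsSFiniteKernel κ] (h : HasCondDistrib U X κ P)
    {f : 𝓧 × 𝓤 → ENNReal} (hf : Measurable f) :
    ∫⁻ ω, f (X ω, U ω) ∂P = ∫⁻ ω, ∫⁻ u, f (X ω, u) ∂κ (X ω) ∂P := by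
  rw [h.lintegral_comp hf.aemeasurable, Measure.lintegral_compProd hf,
    lintegral_map' hf.lintegral_kernel_prod_right'.aemeasurable h.aemeasurable_fst]

lemma integral_of_hasCondDistrib [SFinite P] [IsSFiniteKernel κ] {E : Type*}
    [NormedAddCommGroup E] [NormedSpace ℝ E] (h : HasCondDistrib U X κ P) {f : 𝓧 × 𝓤 → E}
    (hf : StronglyMeasurable f) (hi : Integrable (fun ω => f (X ω, U ω)) P) :
    ∫ ω, f (X ω, U ω) ∂P = ∫ ω, ∫ u, f (X ω, u) ∂κ (X ω) ∂P := by
  have hi' : Integrable f (P.map X ⊗ₘ κ) := by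
    rw [← h.map_eq]
    exact (integrable_map_measure hf.aestronglyMeasurable h.aemeasurable).2 hi
  rw [← integral_map h.aemeasurable hf.aestronglyMeasurable, h.map_eq,
    Measure.integral_compProd hi',
    integral_map h.aemeasurable_fst hf.integral_kernel_prod_right'.aestronglyMeasurable]

lemma integral_le_of_hasCondDistrib [IsProbabilityMeasure P] [IsSFiniteKernel κ]
    (h : HasCondDistrib U X κ P) {f : 𝓧 × 𝓤 → ℝ} (hf : Measurable f)
    (hi : Integrable (fun ω => f (X ω, U ω)) P) {K : ℝ}
    (hK : ∀ x, ∫ u, f (x, u) ∂κ x ≤ K) : ∫ ω, f (X ω, U ω) ∂P ≤ K := by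
  have hi' : Integrable f (P.map X ⊗ₘ κ) := by
    rw [← h.map_eq]
    exact (integrable_map_measure hf.aestronglyMeasurable h.aemeasurable).2 hi
  have : IsProbabilityMeasure (P.map X) := Measure.isProbabilityMeasure_map h.aemeasurable_fst
  rw [← integral_map h.aemeasurable hf.aestronglyMeasurable, h.map_eq,
    Measure.integral_compProd hi']
  calc ∫ x, ∫ u, f (x, u) ∂κ x ∂P.map X ≤ ∫ _, K ∂P.map X :=
        integral_mono hi'.integral_compProd (integrable_const K) hK
    _ = K := by simp

lemma hasSubgaussianMGF_add_compProd {m : Measure 𝓧} [SFinite m] [IsSFiniteKernel κ]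
    {g : 𝓧 → ℝ} {f : 𝓧 × 𝓤 → ℝ} {c d : ℝ≥0} (hgm : Measurable g) (hfm : Measurable f)
    (hg : HasSubgaussianMGF g c m) (hf : ∀ x, HasSubgaussianMGF (fun u => f (x, u)) d (κ x)) :
    HasSubgaussianMGF (fun x => g x.1 + f x) (c + d) (m ⊗ₘ κ) := by
  have hinner : ∀ t x, ∫ u, Real.exp (t * (g x + f (x, u))) ∂κ x
      ≤ Real.exp (t * g x) * Real.exp (d * t ^ 2 / 2) := fun t x => by
    simp_rw [mul_add, Real.exp_add, integral_const_mul]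
    gcongr
    exact (hf x).mgf_le t
  have hbound : ∀ t, Integrable (fun x => Real.exp (t * g x) * Real.exp (d * t ^ 2 / 2)) m :=
    fun t => (hg.integrable_exp_mul t).mul_const _
  have hm : ∀ t, Measurable fun x : 𝓧 × 𝓤 => Real.exp (t * (g x.1 + f x)) := fun t => by
    fun_prop
  have hint : ∀ t, Integrable (fun x : 𝓧 × 𝓤 => Real.exp (t * (g x.1 + f x))) (m ⊗ₘ κ) := by
    intro t
    rw [Measure.integrable_compProd_iff (hm t).aestronglyMeasurable]
    refine ⟨.of_forall fun x => ?_, (hbound t).mono' ?_ (.of_forall fun x => ?_)⟩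
    · simp_rw [mul_add, Real.exp_add]
      exact ((hf x).integrable_exp_mul t).const_mul _
    · exact (hm t).norm.stronglyMeasurable.integral_kernel_prod_right'.aestronglyMeasurable
    · rw [Real.norm_of_nonneg (integral_nonneg fun _ => norm_nonneg _)]
      simpa only [Real.norm_eq_abs, Real.abs_exp] using hinner t x
  refine ⟨hint, fun t => ?_⟩
  calc mgf (fun x => g x.1 + f x) (m ⊗ₘ κ) t
      = ∫ x, ∫ u, Real.exp (t * (g x + f (x, u))) ∂κ x ∂m := Measure.integral_compProd (hint t)
    _ ≤ ∫ x, Real.exp (t * g x) * Real.exp (d * t ^ 2 / 2) ∂m :=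
        integral_mono (hint t).integral_compProd (hbound t) (hinner t)
    _ = mgf g m t * Real.exp (d * t ^ 2 / 2) := integral_mul_const _ _
    _ ≤ Real.exp (c * t ^ 2 / 2) * Real.exp (d * t ^ 2 / 2) := by
        gcongr
        exact hg.mgf_le t
    _ = Real.exp (↑(c + d) * t ^ 2 / 2) := by
        rw [← Real.exp_add]
        push_cast
        ring_nf

end CondDistrib

section Entropy

variable {Ω S 𝓩 : Type*} [MeasurableSpace Ω] [MeasurableSpace S] [DiscreteMeasurableSpace S]
  [MeasurableSpace 𝓩] {P : Measure Ω} {X : Ω → S} {Z : Ω → 𝓩}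

lemma measurable_kernel_real_singleton [Countable S] (κ : Kernel 𝓩 S) :
    Measurable fun x : 𝓩 × S => (κ x.1).real {x.2} :=
  measurable_from_prod_countable_left fun a =>
    (κ.measurable_coe (measurableSet_singleton a)).ennreal_toReal

lemma sum_ofReal_measureReal_singleton {S : Type*} [Fintype S] [MeasurableSpace S]
    [MeasurableSingletonClass S] (ν : Measure S) [IsProbabilityMeasure ν] :
    ∑ a, ENNReal.ofReal (ν.real {a}) = 1 := by
  simp only [ofReal_measureReal (measure_ne_top ν _), sum_measure_singleton, Finset.coe_univ,
    measure_univ]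

lemma lintegral_eq_sum_of_hasCondDistrib [Fintype S] [SFinite P] {κ : Kernel 𝓩 S}
    [IsSFiniteKernel κ] (h : HasCondDistrib X Z κ P) {f : 𝓩 × S → ENNReal} (hf : Measurable f) :
    ∫⁻ ω, f (Z ω, X ω) ∂P = ∫⁻ ω, ∑ a, f (Z ω, a) * κ (Z ω) {a} ∂P := by
  rw [lintegral_of_hasCondDistrib h hf]
  simp_rw [lintegral_fintype]

lemma integral_log_nonpos [IsProbabilityMeasure P] {f : Ω → ℝ} (hf : AEMeasurable f P)
    (hpos : ∀ᵐ ω ∂P, 0 < f ω) (hle : ∫⁻ ω, ENNReal.ofReal (f ω) ∂P ≤ 1) :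
    ∫ ω, Real.log (f ω) ∂P ≤ 0 := by
  by_cases hlog : Integrable (fun ω => Real.log (f ω)) P
  swap
  · exact (integral_undef hlog).le
  have hnn : 0 ≤ᵐ[P] f := hpos.mono fun _ => le_of_lt
  have hint : Integrable f P := (lintegral_ofReal_ne_top_iff_integrable hf.aestronglyMeasurable
    hnn).1 (ne_top_of_le_ne_top ENNReal.one_ne_top hle)
  calc ∫ ω, Real.log (f ω) ∂P ≤ ∫ ω, (f ω - 1) ∂P :=
        integral_mono_ae hlog (hint.sub (integrable_const 1))
          (hpos.mono fun _ => Real.log_le_sub_one_of_pos)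
    _ = ∫ ω, f ω ∂P - 1 := by simp [integral_sub hint (integrable_const 1)]
    _ ≤ 0 := by
        rw [sub_nonpos, integral_eq_lintegral_of_nonneg_ae hnn hf.aestronglyMeasurable]
        exact ENNReal.toReal_le_of_le_ofReal zero_le_one (by simpa using hle)

lemma ae_condProb_pos [Countable S] [SFinite P] {κ : Kernel 𝓩 S} [IsFiniteKernel κ]
    (h : HasCondDistrib X Z κ P) : ∀ᵐ ω ∂P, 0 < (κ (Z ω)).real {X ω} := by
  have hzero : MeasurableSet {x : 𝓩 × S | (κ x.1).real {x.2} = 0} :=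
    measurable_kernel_real_singleton κ (measurableSet_singleton 0)
  suffices ∀ᵐ x ∂P.map (fun ω => (Z ω, X ω)), (κ x.1).real {x.2} ≠ 0 by
    filter_upwards [ae_of_ae_map h.aemeasurable this] with ω hω
    exact measureReal_nonneg.lt_of_ne' hω
  rw [h.map_eq]
  refine (Measure.ae_compProd_iff hzero.compl).2 (.of_forall fun z => ?_)
  refine ae_iff_of_countable.2 fun a ha => ?_
  exact (ENNReal.toReal_pos ha (measure_ne_top _ _)).ne'

lemma integrable_log_condProb [Finite S] [IsFiniteMeasure P] {κ : Kernel 𝓩 S}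
    [IsMarkovKernel κ] (h : HasCondDistrib X Z κ P) :
    Integrable (fun ω => Real.log ((κ (Z ω)).real {X ω})) P := by
  cases nonempty_fintype S
  have hm : Measurable fun x : 𝓩 × S => Real.log ((κ x.1).real {x.2}) :=
    Real.measurable_log.comp (measurable_kernel_real_singleton κ)
  have hbound : ∀ z a, ‖Real.log ((κ z).real {a})‖ₑ * κ z {a} ≤ 1 := fun z a => by
    rw [← ofReal_measureReal (μ := κ z) (s := {a}), Real.enorm_eq_ofReal_abs,
      ← ENNReal.ofReal_mul (abs_nonneg _), ENNReal.ofReal_le_one]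
    rcases (measureReal_nonneg (μ := κ z) (s := {a})).eq_or_lt with h0 | h0
    · simp [← h0]
    · simpa only [abs_mul, abs_of_pos h0] using
        (Real.abs_log_mul_self_lt _ h0 measureReal_le_one).le
  refine ⟨(hm.comp_aemeasurable h.aemeasurable).aestronglyMeasurable, ?_⟩
  calc ∫⁻ ω, ‖Real.log ((κ (Z ω)).real {X ω})‖ₑ ∂P
      = ∫⁻ ω, ∑ a, ‖Real.log ((κ (Z ω)).real {a})‖ₑ * κ (Z ω) {a} ∂P :=
        lintegral_eq_sum_of_hasCondDistrib h hm.enorm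
    _ ≤ ∫⁻ _, ∑ _a : S, 1 ∂P :=
        lintegral_mono fun ω => Finset.sum_le_sum fun a _ => hbound (Z ω) a
    _ < ⊤ := by
        rw [lintegral_const]
        exact ENNReal.mul_lt_top (by simp) (measure_lt_top P _)

lemma lintegral_div_condProb_le [Fintype S] [SFinite P] {κ : Kernel 𝓩 S} [IsFiniteKernel κ]
    (h : HasCondDistrib X Z κ P) {r : 𝓩 × S → ℝ} (hr : Measurable r) (hr0 : ∀ x, 0 ≤ r x) :
    ∫⁻ ω, ENNReal.ofReal (r (Z ω, X ω) / (κ (Z ω)).real {X ω}) ∂P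
      ≤ ∫⁻ ω, ∑ a, ENNReal.ofReal (r (Z ω, a)) ∂P := by
  rw [lintegral_eq_sum_of_hasCondDistrib h
    (f := fun x => ENNReal.ofReal (r x / (κ x.1).real {x.2}))
    (hr.div (measurable_kernel_real_singleton κ)).ennreal_ofReal]
  refine lintegral_mono fun ω => Finset.sum_le_sum fun a _ => ?_
  rw [← ofReal_measureReal (μ := κ (Z ω)) (s := {a}),
    ← ENNReal.ofReal_mul (div_nonneg (hr0 _) measureReal_nonneg)]
  refine ENNReal.ofReal_le_ofReal ?_
  rw [div_mul_eq_mul_div, mul_div_assoc]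
  exact mul_le_of_le_one_right (hr0 _) (div_self_le_one _)

variable [Fintype S] [Nonempty S]

lemma condEntropy_eq_of_hasCondDistrib [IsFiniteMeasure P] {κ : Kernel 𝓩 S} [IsFiniteKernel κ]
    (h : HasCondDistrib X Z κ P) :
    condEntropy X Z P = -∫ ω, Real.log ((κ (Z ω)).real {X ω}) ∂P := by
  have hae := condDistrib_ae_eq_of_measure_eq_compProd Z h.aemeasurable_snd h.map_eq
  rw [condEntropy, ← integral_neg]
  refine integral_congr_ae ?_
  filter_upwards [ae_of_ae_map h.aemeasurable_fst hae] with ω hω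
  rw [hω]

lemma condEntropy_nonneg (X : Ω → S) (Z : Ω → 𝓩) (P : Measure Ω) [IsFiniteMeasure P] :
    0 ≤ condEntropy X Z P :=
  integral_nonneg fun _ => neg_nonneg.2 (Real.log_nonpos measureReal_nonneg measureReal_le_one)

variable [IsProbabilityMeasure P]

lemma entropy_eq_condEntropy_const (hX : AEMeasurable X P) :
    entropy X P = condEntropy X (fun _ => ()) P := by
  have : IsProbabilityMeasure (P.map X) := Measure.isProbabilityMeasure_map hX
  have hlaw : HasCondDistrib X (fun _ => ()) (Kernel.const Unit (P.map X)) P := by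
    refine ⟨by fun_prop, ?_⟩
    rw [Measure.compProd_const, Measure.map_const, measure_univ, one_smul, Measure.dirac_prod,
      AEMeasurable.map_map_of_aemeasurable (by fun_prop) hX]
    rfl
  rw [condEntropy_eq_of_hasCondDistrib hlaw, entropy]
  simp only [Kernel.const_apply]
  rw [← integral_map (f := fun a => Real.log ((P.map X).real {a})) hX
    (measurable_of_finite _).aestronglyMeasurable, integral_fintype Integrable.of_finite]
  simp [map_measureReal_apply_of_aemeasurable hX (measurableSet_singleton _)]

/- Gibbs' inequality: `r (Z, ·)` is a possibly unnormalised prediction of `X` from `Z`. -/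
lemma condEntropy_le_neg_integral_log (hX : AEMeasurable X P) (hZ : AEMeasurable Z P)
    {r : 𝓩 × S → ℝ} (hr : Measurable r) (hr0 : ∀ x, 0 ≤ r x)
    (hpos : ∀ᵐ ω ∂P, 0 < r (Z ω, X ω))
    (hlog : Integrable (fun ω => Real.log (r (Z ω, X ω))) P)
    (hsum : ∫⁻ ω, ∑ a, ENNReal.ofReal (r (Z ω, a)) ∂P ≤ 1) :
    condEntropy X Z P ≤ -∫ ω, Real.log (r (Z ω, X ω)) ∂P := by
  have h := hasCondDistrib_condDistrib hZ hX
  rw [condEntropy_eq_of_hasCondDistrib h, neg_le_neg_iff, ← sub_nonpos,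
    ← integral_sub hlog (integrable_log_condProb h)]
  have hratio : ∫ ω, Real.log (r (Z ω, X ω) / (condDistrib X Z P (Z ω)).real {X ω}) ∂P ≤ 0 :=
    integral_log_nonpos
      ((hr.div (measurable_kernel_real_singleton _)).comp_aemeasurable h.aemeasurable)
      (by filter_upwards [hpos, ae_condProb_pos h] with ω using div_pos)
      ((lintegral_div_condProb_le h hr hr0).trans hsum)
  refine (integral_congr_ae ?_).trans_le hratio
  filter_upwards [hpos, ae_condProb_pos h] with ω h1 h2
  exact (Real.log_div h1.ne' h2.ne').symm

lemma condEntropy_le_condEntropy_comp {𝓩' : Type*} [MeasurableSpace 𝓩'] {π : 𝓩 → 𝓩'}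
    (hX : AEMeasurable X P) (hZ : AEMeasurable Z P) (hπ : Measurable π) :
    condEntropy X Z P ≤ condEntropy X (π ∘ Z) P := by
  have h := hasCondDistrib_condDistrib (hπ.comp_aemeasurable hZ) hX
  rw [condEntropy_eq_of_hasCondDistrib h]
  refine condEntropy_le_neg_integral_log hX hZ
    (r := fun x => (condDistrib X (π ∘ Z) P (π x.1)).real {x.2})
    ((measurable_kernel_real_singleton _).comp (hπ.prodMap measurable_id))
    (fun _ => measureReal_nonneg) (ae_condProb_pos h) (integrable_log_condProb h) ?_
  simp only [sum_ofReal_measureReal_singleton, lintegral_const, measure_univ, mul_one, le_refl]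

lemma condEntropy_le_entropy (hX : AEMeasurable X P) (hZ : AEMeasurable Z P) :
    condEntropy X Z P ≤ entropy X P := by
  rw [entropy_eq_condEntropy_const hX]
  exact condEntropy_le_condEntropy_comp hX hZ measurable_const

/- The prediction of `X` from `Z` is tilted by `exp (s a)` once `W` is observed: this is the
Donsker–Varadhan bound for the conditional mutual information of `X` and `W`. -/
lemma integral_le_condEntropy_sub {𝓦 : Type*} [MeasurableSpace 𝓦] {W : Ω → 𝓦} {κ : Kernel 𝓩 S}
    [IsMarkovKernel κ] {ρ : Kernel 𝓩 𝓦} [IsSFiniteKernel ρ] (hX : HasCondDistrib X Z κ P)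
    (hW : HasCondDistrib W Z ρ P)
    {s : S → 𝓩 × 𝓦 → ℝ} (hs : ∀ a, Measurable (s a))
    (hint : Integrable (fun ω => s (X ω) (Z ω, W ω)) P)
    (hexp : ∀ a z, ∫⁻ w, ENNReal.ofReal (Real.exp (s a (z, w))) ∂ρ z ≤ 1) :
    ∫ ω, s (X ω) (Z ω, W ω) ∂P
      ≤ condEntropy X Z P - condEntropy X (fun ω => (Z ω, W ω)) P := by
  let r : (𝓩 × 𝓦) × S → ℝ := fun x => (κ x.1.1).real {x.2} * Real.exp (s x.2 x.1)
  have hr : Measurable r :=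
    ((measurable_kernel_real_singleton κ).comp (measurable_fst.prodMap measurable_id)).mul
      (measurable_from_prod_countable_left hs).exp
  have hlog : (fun ω => Real.log (r ((Z ω, W ω), X ω))) =ᵐ[P]
      fun ω => Real.log ((κ (Z ω)).real {X ω}) + s (X ω) (Z ω, W ω) := by
    filter_upwards [ae_condProb_pos hX] with ω hω
    rw [Real.log_mul hω.ne' (Real.exp_pos _).ne', Real.log_exp]
  have hlogκ := integrable_log_condProb hX
  have hsum : ∫⁻ ω, ∑ a, ENNReal.ofReal (r ((Z ω, W ω), a)) ∂P ≤ 1 := by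
    rw [lintegral_of_hasCondDistrib hW (f := fun x => ∑ a, ENNReal.ofReal (r (x, a)))
      (by fun_prop)]
    calc ∫⁻ ω, ∫⁻ w, ∑ a, ENNReal.ofReal (r ((Z ω, w), a)) ∂ρ (Z ω) ∂P
        ≤ ∫⁻ ω, ∑ a, ENNReal.ofReal ((κ (Z ω)).real {a}) ∂P :=
          lintegral_mono fun ω => ?_
      _ = 1 := by
          simp only [sum_ofReal_measureReal_singleton, lintegral_const, measure_univ, mul_one]
    rw [lintegral_finsetSum _ fun a _ => by fun_prop]
    refine Finset.sum_le_sum fun a _ => ?_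
    simp only [r, ENNReal.ofReal_mul measureReal_nonneg]
    rw [lintegral_const_mul' _ _ ENNReal.ofReal_ne_top]
    exact mul_le_of_le_one_right' (hexp a (Z ω))
  have gibbs := condEntropy_le_neg_integral_log hX.aemeasurable_snd hW.aemeasurable hr
    (fun _ => mul_nonneg measureReal_nonneg (Real.exp_pos _).le)
    ((ae_condProb_pos hX).mono fun _ hω => mul_pos hω (Real.exp_pos _))
    ((hlogκ.add hint).congr hlog.symm) hsum
  rw [integral_congr_ae hlog, integral_add hlogκ hint] at gibbs
  rw [condEntropy_eq_of_hasCondDistrib hX]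
  linarith

end Entropy

section Belief

variable {Θ 𝓐 𝓨 𝓩 : Type*} [MeasurableSpace Θ] [MeasurableSpace 𝓐] [MeasurableSpace 𝓨]
  [MeasurableSpace 𝓩]

/-- The mean reward of the action `a` under the belief `ν` about the parameter. -/
noncomputable def posteriorMean (p : Kernel (Θ × 𝓐) 𝓨) (R : 𝓨 → ℝ) (ν : Measure Θ) (a : 𝓐) : ℝ :=
  ∫ θ, meanReward p R a θ ∂ν

/-- The contribution of the action `a` to the mean regret of a round of Thompson sampling with
belief `ν`. It is the covariance under `ν` of the mean reward of `a` and of the event that `a` is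
optimal. -/
noncomputable def actionGap (p : Kernel (Θ × 𝓐) 𝓨) (R : 𝓨 → ℝ) (aStar : Θ → 𝓐) (ν : Measure Θ)
    (a : 𝓐) : ℝ :=
  ∫ θ in aStar ⁻¹' {a}, meanReward p R a θ ∂ν - (ν.map aStar).real {a} * posteriorMean p R ν a

/-- The rate at which an observed reward of `a` tilts the belief that `a` is optimal. For rewards
with variance proxy `c` it maximises the expected log-likelihood gain in `tiltScore`; it is `0` if
`a` is almost surely not optimal. -/
noncomputable def tiltSlope (p : Kernel (Θ × 𝓐) 𝓨) (R : 𝓨 → ℝ) (aStar : Θ → 𝓐) (c : ℝ)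
    (ν : Measure Θ) (a : 𝓐) : ℝ :=
  actionGap p R aStar ν a / (c * (ν.map aStar).real {a})

/-- The logarithm of the factor by which the probability that `a'` is optimal is tilted once the
action `a` has led to the outcome `y`: only the probability of the action played changes. -/
noncomputable def tiltScore (p : Kernel (Θ × 𝓐) 𝓨) (R : 𝓨 → ℝ) (aStar : Θ → 𝓐) (c : ℝ)
    (ν : Measure Θ) (a' a : 𝓐) (y : 𝓨) : ℝ :=
  ({a'} : Set 𝓐).indicator (fun a => tiltSlope p R aStar c ν a * (R y - posteriorMean p R ν a)
    - c * tiltSlope p R aStar c ν a ^ 2 / 2) a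

/-- The joint law of the true parameter, the action and the outcome in a round of Thompson sampling
with belief `ν`: the action has the law of the optimal action, but is independent of the true
parameter. -/
noncomputable def roundLaw (p : Kernel (Θ × 𝓐) 𝓨) (aStar : Θ → 𝓐) (ν : Measure Θ) :
    Measure ((Θ × 𝓐) × 𝓨) :=
  (ν.prod (ν.map aStar)) ⊗ₘ p

variable {p : Kernel (Θ × 𝓐) 𝓨} {R : 𝓨 → ℝ} {aStar : Θ → 𝓐} {ν : Measure Θ} {v : ℝ≥0} {B c : ℝ}

lemma isProbabilityMeasure_roundLaw [IsMarkovKernel p] [IsProbabilityMeasure ν]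
    (hA : Measurable aStar) : IsProbabilityMeasure (roundLaw p aStar ν) := by
  have := Measure.isProbabilityMeasure_map (μ := ν) hA.aemeasurable
  unfold roundLaw
  infer_instance

section MeanReward

lemma measurable_meanReward [IsSFiniteKernel p] (hR : Measurable R) :
    Measurable fun x : Θ × 𝓐 => meanReward p R x.2 x.1 :=
  (hR.stronglyMeasurable.comp_measurable measurable_snd).integral_kernel_prod_right'.measurable

lemma measurable_meanReward_right [IsSFiniteKernel p] (hR : Measurable R) (a : 𝓐) :
    Measurable (meanReward p R a) :=
  (measurable_meanReward hR).comp measurable_prodMk_right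

lemma integrable_meanReward [IsSFiniteKernel p] {Ω : Type*} [MeasurableSpace Ω] {P : Measure Ω}
    [IsFiniteMeasure P] (hR : Measurable R) (hB : ∀ θ a, |meanReward p R a θ| ≤ B) {θs : Ω → Θ}
    {A : Ω → 𝓐} (h : AEMeasurable (fun ω => (θs ω, A ω)) P) :
    Integrable (fun ω => meanReward p R (A ω) (θs ω)) P :=
  .of_bound ((measurable_meanReward hR).comp_aemeasurable h).aestronglyMeasurable B
    (.of_forall fun ω => hB (θs ω) (A ω))

lemma hasSubgaussianMGF_reward_sub_meanReward {m : Measure (Θ × 𝓐)} [IsProbabilityMeasure m]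
    [IsSFiniteKernel p] (hR : Measurable R)
    (hsub : ∀ θ a, HasSubgaussianMGF (fun y => R y - meanReward p R a θ) v (p (θ, a))) :
    HasSubgaussianMGF (fun x => R x.2 - meanReward p R x.1.2 x.1.1) v (m ⊗ₘ p) := by
  have hμ := measurable_meanReward (p := p) hR
  simpa using hasSubgaussianMGF_add_compProd (f := fun x => R x.2 - meanReward p R x.1.2 x.1.1)
    measurable_const ((hR.comp measurable_snd).sub (hμ.comp measurable_fst))
    (HasSubgaussianMGF.fun_zero (μ := m)) fun x => hsub x.1 x.2

lemma integrable_reward_compProd {m : Measure (Θ × 𝓐)} [IsProbabilityMeasure m]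
    [IsMarkovKernel p] (hR : Measurable R)
    (hsub : ∀ θ a, HasSubgaussianMGF (fun y => R y - meanReward p R a θ) v (p (θ, a)))
    (hB : ∀ θ a, |meanReward p R a θ| ≤ B) : Integrable (fun x => R x.2) (m ⊗ₘ p) := by
  have hμ : Integrable (fun x => meanReward p R x.1.2 x.1.1) (m ⊗ₘ p) :=
    integrable_meanReward hR hB (by fun_prop)
  exact ((hasSubgaussianMGF_reward_sub_meanReward hR hsub).integrable.add hμ).congr
    (.of_forall fun x => sub_add_cancel _ _)

lemma integrable_reward_of_hasSubgaussianMGF {m : Measure 𝓨} [IsFiniteMeasure m] {r : ℝ}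
    (h : HasSubgaussianMGF (fun y => R y - r) v m) : Integrable R m :=
  (h.integrable.add (integrable_const r)).congr (.of_forall fun _ => sub_add_cancel _ _)

end MeanReward

section Gap

variable [IsProbabilityMeasure ν]

lemma abs_posteriorMean_le (hB : ∀ θ a, |meanReward p R a θ| ≤ B) (a : 𝓐) :
    |posteriorMean p R ν a| ≤ B := by
  simpa [posteriorMean] using norm_integral_le_of_norm_le_const (μ := ν) (f := meanReward p R a)
    (.of_forall fun θ => hB θ a)

variable [MeasurableSingletonClass 𝓐]

lemma abs_actionGap_le (hA : Measurable aStar) (hB : ∀ θ a, |meanReward p R a θ| ≤ B) (a : 𝓐) :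
    |actionGap p R aStar ν a| ≤ 2 * B * (ν.map aStar).real {a} := by
  have hset : |∫ θ in aStar ⁻¹' {a}, meanReward p R a θ ∂ν| ≤ B * (ν.map aStar).real {a} := by
    rw [map_measureReal_apply hA (measurableSet_singleton a)]
    exact norm_setIntegral_le_of_norm_le_const (f := meanReward p R a) (measure_lt_top _ _)
      fun θ _ => hB θ a
  have hmean : |(ν.map aStar).real {a} * posteriorMean p R ν a| ≤ (ν.map aStar).real {a} * B := by
    rw [abs_mul, abs_of_nonneg measureReal_nonneg]
    gcongr
    exact abs_posteriorMean_le hB a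
  calc |actionGap p R aStar ν a| ≤ _ := abs_sub _ _
    _ ≤ B * (ν.map aStar).real {a} + (ν.map aStar).real {a} * B := add_le_add hset hmean
    _ = 2 * B * (ν.map aStar).real {a} := by ring

lemma abs_tiltSlope_le (hA : Measurable aStar) (hB : ∀ θ a, |meanReward p R a θ| ≤ B)
    (hc : 0 ≤ c) (a : 𝓐) : |tiltSlope p R aStar c ν a| ≤ 2 * B / c := by
  have hB0 : 0 ≤ B := (abs_nonneg _).trans (abs_posteriorMean_le (ν := ν) hB a)
  rw [tiltSlope, abs_div, abs_of_nonneg (mul_nonneg hc measureReal_nonneg)]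
  calc |actionGap p R aStar ν a| / (c * (ν.map aStar).real {a})
      ≤ 2 * B * (ν.map aStar).real {a} / (c * (ν.map aStar).real {a}) := by
        gcongr
        exact abs_actionGap_le hA hB a
    _ = 2 * B / c * ((ν.map aStar).real {a} / (ν.map aStar).real {a}) := mul_div_mul_comm _ _ _ _
    _ ≤ 2 * B / c := mul_le_of_le_one_right (by positivity) (div_self_le_one _)

lemma abs_tiltScore_le (hA : Measurable aStar) (hB : ∀ θ a, |meanReward p R a θ| ≤ B)
    (hc : 0 ≤ c) (a' a : 𝓐) (y : 𝓨) :
    |tiltScore p R aStar c ν a' a y|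
      ≤ 2 * B / c * (|R y| + B) + c * (2 * B / c) ^ 2 / 2 := by
  have hm := abs_posteriorMean_le (ν := ν) hB a
  have hB0 : 0 ≤ B := (abs_nonneg _).trans hm
  have hl := abs_tiltSlope_le (ν := ν) hA hB hc a
  rw [tiltScore, ← Real.norm_eq_abs]
  refine (norm_indicator_le_norm_self _ _).trans ?_
  rw [Real.norm_eq_abs]
  refine (abs_sub _ _).trans ?_
  rw [abs_mul, abs_div, abs_mul, abs_of_nonneg hc, abs_pow, abs_two]
  gcongr
  exact (abs_sub _ _).trans (by gcongr)

/- Both sides vanish if `c = 0`, and also if `a` is almost surely not optimal. -/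
lemma measureReal_mul_tiltSlope_gain (hA : Measurable aStar)
    (hB : ∀ θ a, |meanReward p R a θ| ≤ B) (a : 𝓐) :
    (ν.map aStar).real {a} * (tiltSlope p R aStar c ν a * actionGap p R aStar ν a
      - (ν.map aStar).real {a} * (c * tiltSlope p R aStar c ν a ^ 2 / 2))
      = actionGap p R aStar ν a ^ 2 / (2 * c) := by
  have hgap := abs_actionGap_le (ν := ν) hA hB a
  rw [tiltSlope]
  rcases eq_or_ne ((ν.map aStar).real {a}) 0 with hq | hq
  · rw [hq, mul_zero, abs_nonpos_iff] at hgap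
    simp [hq, hgap]
  rcases eq_or_ne c 0 with rfl | hc
  · simp
  field_simp
  ring

lemma mul_actionGap_sub_le (hA : Measurable aStar) (hB : ∀ θ a, |meanReward p R a θ| ≤ B)
    (hc : B ^ 2 ≤ c) (η : ℝ) (a : 𝓐) :
    η * actionGap p R aStar ν a - actionGap p R aStar ν a ^ 2 / (2 * c) ≤ η ^ 2 * c / 2 := by
  rcases ((sq_nonneg B).trans hc).eq_or_lt with rfl | hc0
  · have hB0 : B = 0 := pow_eq_zero_iff two_ne_zero |>.1 (hc.antisymm (sq_nonneg B))
    have hgap : actionGap p R aStar ν a = 0 := by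
      simpa [hB0] using abs_actionGap_le (ν := ν) hA hB a
    simp [hgap]
  · rw [sub_le_iff_le_add, ← sub_nonneg]
    have : η ^ 2 * c / 2 + actionGap p R aStar ν a ^ 2 / (2 * c) - η * actionGap p R aStar ν a
        = (actionGap p R aStar ν a - η * c) ^ 2 / (2 * c) := by
      field_simp
      ring
    rw [this]
    positivity

end Gap

section TiltMeasurable

variable [IsSFiniteKernel p] {b : Kernel 𝓩 Θ}

lemma measurable_posteriorMean (hR : Measurable R) (a : 𝓐) :
    Measurable fun z => posteriorMean p R (b z) a :=
  (measurable_meanReward_right hR a).stronglyMeasurable.integral_kernel.measurable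

variable [MeasurableSingletonClass 𝓐]

lemma measurable_tiltSlope (hR : Measurable R) (hA : Measurable aStar) (c : ℝ) (a : 𝓐) :
    Measurable fun z => tiltSlope p R aStar c (b z) a := by
  have hs : MeasurableSet (aStar ⁻¹' {a}) := hA (measurableSet_singleton a)
  have hq : Measurable fun z => ((b z).map aStar).real {a} := by
    simp only [map_measureReal_apply_of_aemeasurable hA.aemeasurable (measurableSet_singleton a)]
    exact (b.measurable_coe hs).ennreal_toReal
  have hset : Measurable fun z => ∫ θ in aStar ⁻¹' {a}, meanReward p R a θ ∂b z := by
    simp only [← integral_indicator hs]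
    exact ((measurable_meanReward_right hR a).indicator
      hs).stronglyMeasurable.integral_kernel.measurable
  exact (hset.sub (hq.mul (measurable_posteriorMean hR a))).div (hq.const_mul c)

lemma measurable_tiltScore [Countable 𝓐] (hR : Measurable R) (hA : Measurable aStar) (c : ℝ) :
    Measurable fun x : 𝓩 × 𝓐 × 𝓐 × 𝓨 =>
      tiltScore p R aStar c (b x.1) x.2.1 x.2.2.1 x.2.2.2 := by
  classical
  have hslope : Measurable fun x : 𝓩 × 𝓐 => tiltSlope p R aStar c (b x.1) x.2 :=
    measurable_from_prod_countable_left fun a => measurable_tiltSlope hR hA c a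
  have hmean : Measurable fun x : 𝓩 × 𝓐 => posteriorMean p R (b x.1) x.2 :=
    measurable_from_prod_countable_left fun a => measurable_posteriorMean hR a
  have hza : Measurable fun x : 𝓩 × 𝓐 × 𝓐 × 𝓨 => (x.1, x.2.2.1) := by fun_prop
  have hl := hslope.comp hza
  have hm := hmean.comp hza
  simp only [tiltScore, Set.indicator_apply, Set.mem_singleton_iff]
  refine Measurable.ite (measurableSet_eq_fun (by fun_prop) (by fun_prop)) ?_ measurable_const
  exact (hl.mul ((hR.comp (by fun_prop)).sub hm)).sub (((hl.pow_const 2).const_mul c).div_const 2)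

lemma integrable_tiltScore {Ω : Type*} [MeasurableSpace Ω] {P : Measure Ω} [IsFiniteMeasure P]
    [IsMarkovKernel b] [Countable 𝓐] (hR : Measurable R) (hA : Measurable aStar)
    (hB : ∀ θ a, |meanReward p R a θ| ≤ B) (hc : 0 ≤ c) {Z : Ω → 𝓩} {X A : Ω → 𝓐} {Y : Ω → 𝓨}
    (hm : AEMeasurable (fun ω => (Z ω, X ω, A ω, Y ω)) P)
    (hi : Integrable (fun ω => R (Y ω)) P) :
    Integrable (fun ω => tiltScore p R aStar c (b (Z ω)) (X ω) (A ω) (Y ω)) P := by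
  have hbound : Integrable (fun ω => 2 * B / c * (|R (Y ω)| + B) + c * (2 * B / c) ^ 2 / 2) P :=
    ((hi.abs.add (integrable_const B)).const_mul _).add (integrable_const _)
  exact hbound.mono' ((measurable_tiltScore hR hA c).comp_aemeasurable hm).aestronglyMeasurable
    (.of_forall fun ω => abs_tiltScore_le hA hB hc _ _ _)

end TiltMeasurable

section ExpBound

lemma lintegral_exp_le_one_of_hasSubgaussianMGF {Ω : Type*} [MeasurableSpace Ω] {P : Measure Ω}
    {f : Ω → ℝ} {d : ℝ≥0} (hf : HasSubgaussianMGF f d P) (hd : d ≤ c) (l : ℝ) :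
    ∫⁻ ω, ENNReal.ofReal (Real.exp (l * f ω - c * l ^ 2 / 2)) ∂P ≤ 1 := by
  have hmgf : mgf f P l ≤ Real.exp (c * l ^ 2 / 2) := (hf.mgf_le l).trans (by gcongr)
  simp only [Real.exp_sub]
  rw [← ofReal_integral_eq_lintegral_ofReal ((hf.integrable_exp_mul l).div_const _)
    (.of_forall fun _ => by positivity), ENNReal.ofReal_le_one, integral_div]
  exact div_le_one_of_le₀ hmgf (Real.exp_pos _).le

lemma hasSubgaussianMGF_reward_sub_posteriorMean [IsSFiniteKernel p] [IsProbabilityMeasure ν]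
    (hR : Measurable R)
    (hsub : ∀ θ a, HasSubgaussianMGF (fun y => R y - meanReward p R a θ) v (p (θ, a)))
    (hB : ∀ θ a, |meanReward p R a θ| ≤ B) (a : 𝓐) :
    HasSubgaussianMGF (fun x => R x.2 - posteriorMean p R ν a) (‖B‖₊ ^ 2 + v)
      (ν ⊗ₘ p.sectL a) := by
  have hμ := measurable_meanReward_right (p := p) hR a
  have hoeffding : HasSubgaussianMGF (fun θ => meanReward p R a θ - posteriorMean p R ν a)
      (‖B‖₊ ^ 2) ν := by
    have := hasSubgaussianMGF_of_mem_Icc (μ := ν) hμ.aemeasurable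
      (.of_forall fun θ => abs_le.1 (hB θ a))
    rwa [sub_neg_eq_add, ← two_mul, nnnorm_mul, Real.nnnorm_two,
      mul_div_cancel_left₀ _ two_ne_zero] at this
  have hsum := hasSubgaussianMGF_add_compProd (κ := p.sectL a)
    (f := fun x => R x.2 - meanReward p R a x.1) (hμ.sub_const _) (by fun_prop) hoeffding
    (hsub · a)
  exact hsum.congr (.of_forall fun x => by ring)

lemma lintegral_exp_tiltScore_le [IsMarkovKernel p] [IsProbabilityMeasure ν] (hR : Measurable R)
    (hsub : ∀ θ a, HasSubgaussianMGF (fun y => R y - meanReward p R a θ) v (p (θ, a)))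
    (hB : ∀ θ a, |meanReward p R a θ| ≤ B) (hc : v + B ^ 2 ≤ c) (a' a : 𝓐) :
    ∫⁻ θ, ∫⁻ y, ENNReal.ofReal (Real.exp (tiltScore p R aStar c ν a' a y)) ∂p (θ, a) ∂ν ≤ 1 := by
  rcases ne_or_eq a a' with ha | rfl
  · simp [tiltScore, ha]
  simp only [tiltScore, Set.indicator_of_mem (Set.mem_singleton a)]
  have hvar : ((‖B‖₊ ^ 2 + v : ℝ≥0) : ℝ) ≤ c := by simpa [add_comm] using hc
  have hexp := lintegral_exp_le_one_of_hasSubgaussianMGF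
    (hasSubgaussianMGF_reward_sub_posteriorMean (ν := ν) hR hsub hB a) hvar
    (tiltSlope p R aStar c ν a)
  rwa [Measure.lintegral_compProd (by fun_prop)] at hexp

end ExpBound

section RoundLaw

lemma integral_mul_sub_sub {Ω : Type*} [MeasurableSpace Ω] {P : Measure Ω} [IsFiniteMeasure P]
    {f : Ω → ℝ} (hf : Integrable f P) (l m k : ℝ) :
    ∫ ω, (l * (f ω - m) - k) ∂P = l * (∫ ω, f ω ∂P - P.real .univ * m) - P.real .univ * k := by
  have hfm : Integrable (fun ω => f ω - m) P := hf.sub (integrable_const m)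
  rw [integral_sub (hfm.const_mul l) (integrable_const k),
    integral_const_mul, integral_sub hf (integrable_const m), integral_const, integral_const,
    smul_eq_mul, smul_eq_mul]

variable [IsMarkovKernel p] [IsProbabilityMeasure ν]

lemma integrable_regret_roundLaw (hR : Measurable R) (hA : Measurable aStar)
    (hsub : ∀ θ a, HasSubgaussianMGF (fun y => R y - meanReward p R a θ) v (p (θ, a)))
    (hB : ∀ θ a, |meanReward p R a θ| ≤ B) :
    Integrable (fun x => meanReward p R (aStar x.1.1) x.1.1 - R x.2) (roundLaw p aStar ν) := by
  have := isProbabilityMeasure_roundLaw (p := p) (ν := ν) hA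
  have := Measure.isProbabilityMeasure_map (μ := ν) hA.aemeasurable
  exact (integrable_meanReward hR hB (by fun_prop)).sub (integrable_reward_compProd hR hsub hB)

variable [MeasurableSingletonClass 𝓐]

lemma integrable_tiltScore_roundLaw [Countable 𝓐] (hR : Measurable R) (hA : Measurable aStar)
    (hsub : ∀ θ a, HasSubgaussianMGF (fun y => R y - meanReward p R a θ) v (p (θ, a)))
    (hB : ∀ θ a, |meanReward p R a θ| ≤ B) (hc : 0 ≤ c) :
    Integrable (fun x => tiltScore p R aStar c ν (aStar x.1.1) x.1.2 x.2)
      (roundLaw p aStar ν) := by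
  have := isProbabilityMeasure_roundLaw (p := p) (ν := ν) hA
  have := Measure.isProbabilityMeasure_map (μ := ν) hA.aemeasurable
  exact integrable_tiltScore (b := Kernel.const Unit ν) (Z := fun _ => ()) hR hA hB hc
    (by fun_prop) (integrable_reward_compProd hR hsub hB)

lemma lintegral_exp_tiltScore_roundLaw_le [Countable 𝓐] (hR : Measurable R) (hA : Measurable aStar)
    (hsub : ∀ θ a, HasSubgaussianMGF (fun y => R y - meanReward p R a θ) v (p (θ, a)))
    (hB : ∀ θ a, |meanReward p R a θ| ≤ B) (hc : v + B ^ 2 ≤ c) (a' : 𝓐) :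
    ∫⁻ x, ENNReal.ofReal (Real.exp (tiltScore p R aStar c ν a' x.1.2 x.2)) ∂roundLaw p aStar ν
      ≤ 1 := by
  have := Measure.isProbabilityMeasure_map (μ := ν) hA.aemeasurable
  have hscore : Measurable fun x : (Θ × 𝓐) × 𝓨 => tiltScore p R aStar c ν a' x.1.2 x.2 :=
    (measurable_tiltScore (p := p) (b := Kernel.const Unit ν) hR hA c).comp
      (f := fun x : (Θ × 𝓐) × 𝓨 => ((), a', x.1.2, x.2)) (by fun_prop)
  have hexp := hscore.exp.ennreal_ofReal
  rw [roundLaw, Measure.lintegral_compProd hexp,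
    lintegral_prod_symm _ hexp.lintegral_kernel_prod_right'.aemeasurable]
  calc _ ≤ ∫⁻ _, 1 ∂ν.map aStar :=
        lintegral_mono fun a => lintegral_exp_tiltScore_le hR hsub hB hc a' a
    _ = 1 := by simp

lemma integral_roundLaw [Fintype 𝓐] (hA : Measurable aStar) {f : (Θ × 𝓐) × 𝓨 → ℝ}
    (hf : Integrable f (roundLaw p aStar ν)) :
    ∫ x, f x ∂roundLaw p aStar ν
      = ∑ a, (ν.map aStar).real {a} * ∫ θ, ∫ y, f ((θ, a), y) ∂p (θ, a) ∂ν := by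
  have := Measure.isProbabilityMeasure_map (μ := ν) hA.aemeasurable
  unfold roundLaw at hf ⊢
  have hmean : Integrable (fun x => ∫ y, f (x, y) ∂p x) (ν.prod (ν.map aStar)) :=
    Integrable.integral_compProd (κ := Kernel.const Unit _) (η := Kernel.prodMkLeft Unit p)
      (a := ()) hf
  rw [Measure.integral_compProd hf, integral_prod_symm _ hmean, integral_fintype .of_finite]
  simp only [smul_eq_mul]

lemma integral_tiltScore_optimal (hR : Measurable R) (hA : Measurable aStar)
    (hsub : ∀ θ a, HasSubgaussianMGF (fun y => R y - meanReward p R a θ) v (p (θ, a)))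
    (hB : ∀ θ a, |meanReward p R a θ| ≤ B) (a : 𝓐) :
    ∫ θ, ∫ y, tiltScore p R aStar c ν (aStar θ) a y ∂p (θ, a) ∂ν
      = tiltSlope p R aStar c ν a * actionGap p R aStar ν a
        - (ν.map aStar).real {a} * (c * tiltSlope p R aStar c ν a ^ 2 / 2) := by
  have hs : MeasurableSet (aStar ⁻¹' {a}) := hA (measurableSet_singleton a)
  have hμ : Integrable (meanReward p R a) (ν.restrict (aStar ⁻¹' {a})) :=
    (integrable_meanReward hR hB (by fun_prop)).restrict
  have hinner (θ : Θ) : ∫ y, tiltScore p R aStar c ν (aStar θ) a y ∂p (θ, a)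
      = (aStar ⁻¹' {a}).indicator (fun θ => tiltSlope p R aStar c ν a
        * (meanReward p R a θ - posteriorMean p R ν a) - c * tiltSlope p R aStar c ν a ^ 2 / 2)
        θ := by
    by_cases ha : aStar θ = a
    · simp only [tiltScore, ha, Set.indicator_of_mem (Set.mem_singleton a)]
      rw [Set.indicator_of_mem (by exact ha),
        integral_mul_sub_sub (integrable_reward_of_hasSubgaussianMGF (hsub θ a))]
      simp [meanReward]
    · rw [Set.indicator_of_notMem (by exact ha)]
      simp [tiltScore, Ne.symm ha]
  simp only [hinner]
  rw [integral_indicator hs, integral_mul_sub_sub hμ, actionGap, measureReal_restrict_apply_univ,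
    map_measureReal_apply hA (measurableSet_singleton a)]

variable [Fintype 𝓐]

lemma integral_meanReward_optimal (hR : Measurable R) (hA : Measurable aStar)
    (hB : ∀ θ a, |meanReward p R a θ| ≤ B) :
    ∫ θ, meanReward p R (aStar θ) θ ∂ν = ∑ a, ∫ θ in aStar ⁻¹' {a}, meanReward p R a θ ∂ν := by
  classical
  have hs (a : 𝓐) : MeasurableSet (aStar ⁻¹' {a}) := hA (measurableSet_singleton a)
  simp only [← integral_indicator (hs _)]
  rw [← integral_finsetSum _ fun a _ =>
    (integrable_meanReward hR hB (by fun_prop)).indicator (hs a)]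
  simp [Set.indicator_apply]

lemma integral_regret_roundLaw (hR : Measurable R) (hA : Measurable aStar)
    (hsub : ∀ θ a, HasSubgaussianMGF (fun y => R y - meanReward p R a θ) v (p (θ, a)))
    (hB : ∀ θ a, |meanReward p R a θ| ≤ B) :
    ∫ x, (meanReward p R (aStar x.1.1) x.1.1 - R x.2) ∂roundLaw p aStar ν
      = ∑ a, actionGap p R aStar ν a := by
  have := Measure.isProbabilityMeasure_map (μ := ν) hA.aemeasurable
  have hopt : Integrable (fun θ => meanReward p R (aStar θ) θ) ν :=
    integrable_meanReward hR hB (by fun_prop)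
  rw [integral_roundLaw hA (integrable_regret_roundLaw hR hA hsub hB)]
  have hinner (a : 𝓐) : ∫ θ, ∫ y, (meanReward p R (aStar θ) θ - R y) ∂p (θ, a) ∂ν
      = ∫ θ, meanReward p R (aStar θ) θ ∂ν - posteriorMean p R ν a := by
    rw [posteriorMean, ← integral_sub hopt (integrable_meanReward hR hB (by fun_prop))]
    congr 1 with θ
    rw [integral_sub (integrable_const _) (integrable_reward_of_hasSubgaussianMGF (hsub θ a))]
    simp [meanReward]
  have hone : ∑ a, (ν.map aStar).real {a} = 1 := by
    rw [sum_measureReal_singleton, Finset.coe_univ, probReal_univ]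
  simp only [hinner, mul_sub, Finset.sum_sub_distrib, ← Finset.sum_mul, hone, one_mul, actionGap,
    integral_meanReward_optimal hR hA hB]

lemma integral_tiltScore_roundLaw (hR : Measurable R) (hA : Measurable aStar)
    (hsub : ∀ θ a, HasSubgaussianMGF (fun y => R y - meanReward p R a θ) v (p (θ, a)))
    (hB : ∀ θ a, |meanReward p R a θ| ≤ B) (hc : 0 ≤ c) :
    ∫ x, tiltScore p R aStar c ν (aStar x.1.1) x.1.2 x.2 ∂roundLaw p aStar ν
      = ∑ a, actionGap p R aStar ν a ^ 2 / (2 * c) := by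
  rw [integral_roundLaw hA (integrable_tiltScore_roundLaw hR hA hsub hB hc)]
  simp only [integral_tiltScore_optimal hR hA hsub hB, measureReal_mul_tiltSlope_gain hA hB]

lemma integral_regret_sub_tiltScore_le (hR : Measurable R) (hA : Measurable aStar)
    (hsub : ∀ θ a, HasSubgaussianMGF (fun y => R y - meanReward p R a θ) v (p (θ, a)))
    (hB : ∀ θ a, |meanReward p R a θ| ≤ B) (hc : B ^ 2 ≤ c) (η : ℝ) :
    ∫ x, (η * (meanReward p R (aStar x.1.1) x.1.1 - R x.2)
        - tiltScore p R aStar c ν (aStar x.1.1) x.1.2 x.2) ∂roundLaw p aStar ν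
      ≤ Fintype.card 𝓐 * (η ^ 2 * c / 2) := by
  have hc0 : 0 ≤ c := (sq_nonneg B).trans hc
  rw [integral_sub ((integrable_regret_roundLaw hR hA hsub hB).const_mul η)
      (integrable_tiltScore_roundLaw hR hA hsub hB hc0), integral_const_mul,
    integral_regret_roundLaw hR hA hsub hB, integral_tiltScore_roundLaw hR hA hsub hB hc0,
    Finset.mul_sum, ← Finset.sum_sub_distrib]
  simpa using Finset.sum_le_card_nsmul Finset.univ _ _
    fun a _ => mul_actionGap_sub_le (ν := ν) hA hB hc η a

end RoundLaw

section Round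

/-- The joint law of the true parameter, the action and the outcome in a round of Thompson sampling
given the data `z` of the learner, whose belief is `b z`. -/
noncomputable def roundKernel (p : Kernel (Θ × 𝓐) 𝓨) (aStar : Θ → 𝓐) (b : Kernel 𝓩 Θ) :
    Kernel 𝓩 ((Θ × 𝓐) × 𝓨) :=
  (b ×ₖ b.map aStar) ⊗ₖ Kernel.prodMkLeft 𝓩 p

variable {b : Kernel 𝓩 Θ}

instance : IsSFiniteKernel (roundKernel p aStar b) := by unfold roundKernel; infer_instance

variable [IsMarkovKernel p]

variable {Ω : Type*} [MeasurableSpace Ω] {P : Measure Ω} {θs : Ω → Θ}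
  {A : Ω → 𝓐} {Y Ystar : Ω → 𝓨} {Z : Ω → 𝓩}

lemma hasCondDistrib_outcome_of_round [IsFiniteMeasure P]
    (hround : HasCondDistrib (fun ω => ((θs ω, A ω), Y ω)) Z (roundKernel p aStar b) P) :
    HasCondDistrib Y (fun ω => (θs ω, A ω)) p P :=
  HasCondDistrib.comp_right (f := Prod.snd) (hf := measurable_snd)
    (HasCondDistrib.of_compProd hround)

lemma roundKernel_apply [IsMarkovKernel b] (hA : Measurable aStar) (z : 𝓩) :
    roundKernel p aStar b z = roundLaw p aStar (b z) := by
  rw [roundKernel, roundLaw, Kernel.compProd_apply_eq_compProd_sectR, Kernel.sectR_prodMkLeft,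
    Kernel.prod_apply, Kernel.map_apply _ hA]

lemma hasCondDistrib_optimalAction [IsFiniteMeasure P] [IsMarkovKernel b] (hA : Measurable aStar)
    (hround : HasCondDistrib (fun ω => ((θs ω, A ω), Y ω)) Z (roundKernel p aStar b) P) :
    HasCondDistrib (aStar ∘ θs) Z (b.map aStar) P := by
  have := Kernel.IsMarkovKernel.map b hA
  have hθ := hround.fst.fst
  rw [roundKernel, Kernel.fst_compProd, Kernel.fst_prod] at hθ
  exact hθ.comp_left hA

variable [IsProbabilityMeasure P]

lemma integrable_reward {S : Ω → Θ × 𝓐} (hR : Measurable R)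
    (hsub : ∀ θ a, HasSubgaussianMGF (fun y => R y - meanReward p R a θ) v (p (θ, a)))
    (hB : ∀ θ a, |meanReward p R a θ| ≤ B) (hY : HasCondDistrib Y S p P) :
    Integrable (fun ω => R (Y ω)) P := by
  have := Measure.isProbabilityMeasure_map hY.aemeasurable_fst
  have hi := integrable_reward_compProd (m := P.map S) hR hsub hB
  rw [← hY.map_eq] at hi
  exact hi.comp_aemeasurable hY.aemeasurable

lemma integral_reward {S : Ω → Θ × 𝓐} (hR : Measurable R)
    (hsub : ∀ θ a, HasSubgaussianMGF (fun y => R y - meanReward p R a θ) v (p (θ, a)))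
    (hB : ∀ θ a, |meanReward p R a θ| ≤ B) (hY : HasCondDistrib Y S p P) :
    ∫ ω, R (Y ω) ∂P = ∫ ω, meanReward p R (S ω).2 (S ω).1 ∂P :=
  integral_of_hasCondDistrib hY (f := fun x => R x.2)
    (hR.comp measurable_snd).stronglyMeasurable (integrable_reward hR hsub hB hY)

variable [IsMarkovKernel b]

lemma integrable_tiltScore_round [Countable 𝓐] [MeasurableSingletonClass 𝓐]
    (hR : Measurable R) (hA : Measurable aStar)
    (hsub : ∀ θ a, HasSubgaussianMGF (fun y => R y - meanReward p R a θ) v (p (θ, a)))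
    (hB : ∀ θ a, |meanReward p R a θ| ≤ B) (hc : 0 ≤ c)
    (hround : HasCondDistrib (fun ω => ((θs ω, A ω), Y ω)) Z (roundKernel p aStar b) P) :
    Integrable (fun ω => tiltScore p R aStar c (b (Z ω)) (aStar (θs ω)) (A ω) (Y ω)) P := by
  have hm : AEMeasurable (fun ω => (Z ω, aStar (θs ω), A ω, Y ω)) P :=
    Measurable.comp_aemeasurable (g := fun x : 𝓩 × (Θ × 𝓐) × 𝓨 =>
      (x.1, aStar x.2.1.1, x.2.1.2, x.2.2)) (by fun_prop) hround.aemeasurable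
  exact integrable_tiltScore hR hA hB hc hm
    (integrable_reward hR hsub hB (hasCondDistrib_outcome_of_round hround))

variable [Fintype 𝓐] [DiscreteMeasurableSpace 𝓐]

lemma integral_tiltScore_le_condEntropy_sub [Nonempty 𝓐] (hR : Measurable R)
    (hA : Measurable aStar)
    (hsub : ∀ θ a, HasSubgaussianMGF (fun y => R y - meanReward p R a θ) v (p (θ, a)))
    (hB : ∀ θ a, |meanReward p R a θ| ≤ B) (hc : v + B ^ 2 ≤ c)
    (hround : HasCondDistrib (fun ω => ((θs ω, A ω), Y ω)) Z (roundKernel p aStar b) P) :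
    ∫ ω, tiltScore p R aStar c (b (Z ω)) (aStar (θs ω)) (A ω) (Y ω) ∂P
      ≤ condEntropy (aStar ∘ θs) Z P
        - condEntropy (aStar ∘ θs) (fun ω => (Z ω, A ω, Y ω)) P := by
  have := Kernel.IsMarkovKernel.map b hA
  have hobs : Measurable fun x : (Θ × 𝓐) × 𝓨 => (x.1.2, x.2) := by fun_prop
  have hs (a : 𝓐) :
      Measurable fun x : 𝓩 × 𝓐 × 𝓨 => tiltScore p R aStar c (b x.1) a x.2.1 x.2.2 :=
    (measurable_tiltScore hR hA c).comp (f := fun x : 𝓩 × 𝓐 × 𝓨 => (x.1, a, x.2)) (by fun_prop)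
  have hexp (a : 𝓐) (z : 𝓩) :
      ∫⁻ w, ENNReal.ofReal (Real.exp (tiltScore p R aStar c (b z) a w.1 w.2))
        ∂(roundKernel p aStar b).map (fun x => (x.1.2, x.2)) z ≤ 1 := by
    have hz : Measurable fun w : 𝓐 × 𝓨 => tiltScore p R aStar c (b z) a w.1 w.2 :=
      (hs a).comp measurable_prodMk_left
    rw [Kernel.lintegral_map _ hobs _ hz.exp.ennreal_ofReal, roundKernel_apply hA]
    exact lintegral_exp_tiltScore_roundLaw_le hR hA hsub hB hc a
  have hc0 : 0 ≤ c := (by positivity : (0 : ℝ) ≤ v + B ^ 2).trans hc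
  exact integral_le_condEntropy_sub
    (s := fun a x => tiltScore p R aStar c (b x.1) a x.2.1 x.2.2)
    (hasCondDistrib_optimalAction hA hround) (hround.comp_left hobs) hs
    (integrable_tiltScore_round hR hA hsub hB hc0 hround) hexp

lemma integral_regret_sub_tiltScore_round_le (hR : Measurable R) (hA : Measurable aStar)
    (hsub : ∀ θ a, HasSubgaussianMGF (fun y => R y - meanReward p R a θ) v (p (θ, a)))
    (hB : ∀ θ a, |meanReward p R a θ| ≤ B) (hc : B ^ 2 ≤ c) (η : ℝ)
    (hround : HasCondDistrib (fun ω => ((θs ω, A ω), Y ω)) Z (roundKernel p aStar b) P) :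
    ∫ ω, (η * (meanReward p R (aStar (θs ω)) (θs ω) - R (Y ω))
        - tiltScore p R aStar c (b (Z ω)) (aStar (θs ω)) (A ω) (Y ω)) ∂P
      ≤ Fintype.card 𝓐 * (η ^ 2 * c / 2) := by
  have hopt : AEMeasurable (fun ω => (θs ω, aStar (θs ω))) P :=
    (measurable_id.prodMk hA).comp_aemeasurable hround.aemeasurable_snd.fst.fst
  have hregret := (integrable_meanReward hR hB hopt).sub
    (integrable_reward hR hsub hB (hasCondDistrib_outcome_of_round hround))
  have hscore := integrable_tiltScore_round hR hA hsub hB ((sq_nonneg B).trans hc) hround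
  have hscore_meas : Measurable fun x : 𝓩 × (Θ × 𝓐) × 𝓨 =>
      tiltScore p R aStar c (b x.1) (aStar x.2.1.1) x.2.1.2 x.2.2 :=
    (measurable_tiltScore hR hA c).comp (f := fun x : 𝓩 × (Θ × 𝓐) × 𝓨 =>
      (x.1, aStar x.2.1.1, x.2.1.2, x.2.2)) (by fun_prop)
  have hmean_meas : Measurable fun θ => meanReward p R (aStar θ) θ :=
    (measurable_meanReward hR).comp (measurable_id.prodMk hA)
  refine integral_le_of_hasCondDistrib (f := fun x => η * (meanReward p R (aStar x.2.1.1) x.2.1.1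
      - R x.2.2) - tiltScore p R aStar c (b x.1) (aStar x.2.1.1) x.2.1.2 x.2.2)
    hround ?_ ((hregret.const_mul η).sub hscore) fun z => ?_
  · exact (((hmean_meas.comp (by fun_prop)).sub (hR.comp (by fun_prop))).const_mul η).sub
      hscore_meas
  · rw [roundKernel_apply hA]
    exact integral_regret_sub_tiltScore_le hR hA hsub hB hc η

lemma mul_integral_regret_le [Nonempty 𝓐] (hR : Measurable R) (hA : Measurable aStar)
    (hsub : ∀ θ a, HasSubgaussianMGF (fun y => R y - meanReward p R a θ) v (p (θ, a)))
    (hB : ∀ θ a, |meanReward p R a θ| ≤ B) (hc : v + B ^ 2 ≤ c) (η : ℝ)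
    (hround : HasCondDistrib (fun ω => ((θs ω, A ω), Y ω)) Z (roundKernel p aStar b) P)
    (hstar : HasCondDistrib Ystar (fun ω => (θs ω, aStar (θs ω))) p P) :
    η * ∫ ω, (R (Ystar ω) - R (Y ω)) ∂P
      ≤ condEntropy (aStar ∘ θs) Z P - condEntropy (aStar ∘ θs) (fun ω => (Z ω, A ω, Y ω)) P
        + Fintype.card 𝓐 * (η ^ 2 * c / 2) := by
  have hBc : B ^ 2 ≤ c := (le_add_of_nonneg_left v.coe_nonneg).trans hc
  have hstar_int := integrable_meanReward hR hB hstar.aemeasurable_fst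
  have hreward_int := integrable_reward hR hsub hB (hasCondDistrib_outcome_of_round hround)
  have hregret_int : Integrable
      (fun ω => meanReward p R (aStar (θs ω)) (θs ω) - R (Y ω)) P := hstar_int.sub hreward_int
  have hgain := integral_tiltScore_le_condEntropy_sub hR hA hsub hB hc hround
  have hcost := integral_regret_sub_tiltScore_round_le hR hA hsub hB hBc η hround
  rw [integral_sub (hregret_int.const_mul η)
      (integrable_tiltScore_round hR hA hsub hB ((sq_nonneg B).trans hBc) hround),
    integral_const_mul, integral_sub hstar_int hreward_int,
    ← integral_reward hR hsub hB hstar] at hcost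
  rw [integral_sub (integrable_reward hR hsub hB hstar) hreward_int]
  linarith

end Round

end Belief

section Regret

variable {Θ 𝓐 𝓨 Ω : Type*} [MeasurableSpace Θ] [StandardBorelSpace Θ] [Nonempty Θ]
  [MeasurableSpace 𝓐] [MeasurableSpace 𝓨] [MeasurableSpace Ω]
  {p : Kernel (Θ × 𝓐) 𝓨} [IsMarkovKernel p] {R : 𝓨 → ℝ} {v : ℝ≥0} {B c : ℝ}
  {aStar : Θ → 𝓐} {hA : Measurable aStar} {P₀ : Measure Θ} {N : ℕ} {P : Measure Ω}
  {θs : Ω → Θ} {D : Ω → Fin N → 𝓨} {θhat : ℕ → Ω → Θ} {A : ℕ → Ω → 𝓐}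
  {Y Ystar : ℕ → Ω → 𝓨}

instance [IsFiniteMeasure P] (t : ℕ) : IsMarkovKernel (belief P θs D A Y t) := by
  unfold belief; infer_instance

namespace IsExpertThompsonSampling

section Laws

variable [IsFiniteMeasure P] (h : IsExpertThompsonSampling p aStar hA P₀ N P θs D θhat A Y Ystar)

include h

lemma aemeasurable_data (t : ℕ) : AEMeasurable (fun ω => (D ω, history A Y t ω)) P :=
  (h.sample_law t).aemeasurable_fst.snd

lemma aemeasurable_optimalAction : AEMeasurable (aStar ∘ θs) P :=
  hA.comp_aemeasurable h.param_law.aemeasurable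

lemma hasCondDistrib_belief (t : ℕ) :
    HasCondDistrib θs (fun ω => (D ω, history A Y t ω)) (belief P θs D A Y t) P :=
  hasCondDistrib_condDistrib (h.aemeasurable_data t) h.param_law.aemeasurable

lemma hasCondDistrib_action (t : ℕ) :
    HasCondDistrib (A t) (fun ω => ((D ω, history A Y t ω), θs ω))
      (Kernel.prodMkRight Θ ((belief P θs D A Y t).map aStar)) P := by
  have hsample : HasCondDistrib (θhat t) (fun ω => ((D ω, history A Y t ω), θs ω))
      (Kernel.prodMkRight Θ (belief P θs D A Y t)) P :=
    HasCondDistrib.comp_right (κ := Kernel.prodMkRight Θ (belief P θs D A Y t)) (f := Prod.swap)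
      (hf := measurable_swap) (h.sample_law t)
  rw [show A t = aStar ∘ θhat t from funext (h.action_eq t), Kernel.prodMkRight,
    Kernel.comap_map_comm _ _ hA]
  exact hsample.comp_left hA

lemma hasCondDistrib_outcome (t : ℕ) :
    HasCondDistrib (Y t) (fun ω => ((D ω, history A Y t ω), θs ω, A t ω))
      (Kernel.prodMkLeft ((Fin N → 𝓨) × (Fin t → 𝓐 × 𝓨)) p) P :=
  HasCondDistrib.comp_right (κ := Kernel.prodMkLeft ((Fin N → 𝓨) × (Fin t → 𝓐 × 𝓨)) p)
    (f := fun x : Θ × (Fin N → 𝓨) × (Fin t → 𝓐 × 𝓨) × 𝓐 => ((x.2.1, x.2.2.1), x.1, x.2.2.2))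
    (hf := by fun_prop) (h.outcome_law t)

lemma hasCondDistrib_optimalOutcome (t : ℕ) :
    HasCondDistrib (Ystar t) (fun ω => (θs ω, aStar (θs ω))) p P :=
  HasCondDistrib.comp_right (f := fun θ => (θ, aStar θ)) (hf := measurable_id.prodMk hA)
    (h.optimal_law t)

lemma hasCondDistrib_round (t : ℕ) :
    HasCondDistrib (fun ω => ((θs ω, A t ω), Y t ω)) (fun ω => (D ω, history A Y t ω))
      (roundKernel p aStar (belief P θs D A Y t)) P := by
  have := Kernel.IsMarkovKernel.map (belief P θs D A Y t) hA
  have hprod : belief P θs D A Y t ⊗ₖ Kernel.prodMkRight Θ ((belief P θs D A Y t).map aStar)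
      = belief P θs D A Y t ×ₖ (belief P θs D A Y t).map aStar := by
    ext z : 1
    rw [Kernel.compProd_apply_eq_compProd_sectR, Kernel.prod_apply]
    exact Measure.compProd_const (μ := belief P θs D A Y t z)
      (ν := (belief P θs D A Y t).map aStar z)
  have hpair := hasCondDistrib_prodMk (h.hasCondDistrib_belief t) (h.hasCondDistrib_action t)
  rw [hprod] at hpair
  exact hasCondDistrib_prodMk hpair (h.hasCondDistrib_outcome t)

end Laws

variable [IsProbabilityMeasure P]
  (h : IsExpertThompsonSampling p aStar hA P₀ N P θs D θhat A Y Ystar)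

include h

lemma integrable_regret_round (hR : Measurable R)
    (hsub : ∀ θ a, HasSubgaussianMGF (fun y => R y - meanReward p R a θ) v (p (θ, a)))
    (hB : ∀ θ a, |meanReward p R a θ| ≤ B) (t : ℕ) :
    Integrable (fun ω => R (Ystar t ω) - R (Y t ω)) P :=
  (integrable_reward hR hsub hB (h.hasCondDistrib_optimalOutcome t)).sub
    (integrable_reward hR hsub hB (hasCondDistrib_outcome_of_round (h.hasCondDistrib_round t)))

lemma integrable_regret (hR : Measurable R)
    (hsub : ∀ θ a, HasSubgaussianMGF (fun y => R y - meanReward p R a θ) v (p (θ, a)))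
    (hB : ∀ θ a, |meanReward p R a θ| ≤ B) (T : ℕ) : Integrable (regret R Y Ystar T) P :=
  integrable_finsetSum _ fun t _ => h.integrable_regret_round hR hsub hB t

lemma integral_regret_succ (hR : Measurable R)
    (hsub : ∀ θ a, HasSubgaussianMGF (fun y => R y - meanReward p R a θ) v (p (θ, a)))
    (hB : ∀ θ a, |meanReward p R a θ| ≤ B) (T : ℕ) :
    ∫ ω, regret R Y Ystar (T + 1) ω ∂P
      = ∫ ω, regret R Y Ystar T ω ∂P + ∫ ω, (R (Ystar T ω) - R (Y T ω)) ∂P := by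
  simp only [regret, Finset.sum_range_succ]
  exact integral_add (h.integrable_regret hR hsub hB T) (h.integrable_regret_round hR hsub hB T)

variable [Fintype 𝓐] [Nonempty 𝓐] [DiscreteMeasurableSpace 𝓐]

lemma condEntropy_history_succ_le (T : ℕ) :
    condEntropy (aStar ∘ θs) (fun ω => (D ω, history A Y (T + 1) ω)) P
      ≤ condEntropy (aStar ∘ θs) (fun ω => ((D ω, history A Y T ω), A T ω, Y T ω)) P :=
  condEntropy_le_condEntropy_comp
    (π := fun z : (Fin N → 𝓨) × (Fin (T + 1) → 𝓐 × 𝓨) =>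
      ((z.1, fun s : Fin T => z.2 s.castSucc), z.2 (Fin.last T)))
    h.aemeasurable_optimalAction (h.aemeasurable_data (T + 1)) (by fun_prop)

lemma mul_integral_regret_le_condEntropy_sub (hR : Measurable R)
    (hsub : ∀ θ a, HasSubgaussianMGF (fun y => R y - meanReward p R a θ) v (p (θ, a)))
    (hB : ∀ θ a, |meanReward p R a θ| ≤ B) (hc : v + B ^ 2 ≤ c) (η : ℝ) (T : ℕ) :
    η * ∫ ω, regret R Y Ystar T ω ∂P
      ≤ condEntropy (aStar ∘ θs) D P
        - condEntropy (aStar ∘ θs) (fun ω => (D ω, history A Y T ω)) P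
        + T * (Fintype.card 𝓐 * (η ^ 2 * c / 2)) := by
  induction T with
  | zero =>
    simpa [regret, Function.comp_def] using condEntropy_le_condEntropy_comp (π := Prod.fst)
      h.aemeasurable_optimalAction (h.aemeasurable_data 0) measurable_fst
  | succ T ih =>
    have hround := mul_integral_regret_le hR hA hsub hB hc η (h.hasCondDistrib_round T)
      (h.hasCondDistrib_optimalOutcome T)
    have hdata := h.condEntropy_history_succ_le T
    rw [h.integral_regret_succ hR hsub hB]
    push_cast
    linarith

end IsExpertThompsonSampling

lemma le_sqrt_of_forall_mul_le {x H K : ℝ} (h : ∀ η : ℝ, η * x ≤ H + η ^ 2 * K) :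
    x ≤ √(4 * K * H) := by
  have hdiscrim : discrim K (-x) H ≤ 0 := discrim_le_zero fun η => by linarith [h η]
  exact Real.le_sqrt_of_sq_le (by rw [discrim] at hdiscrim; linarith)

theorem theorem1_general [IsProbabilityMeasure P] [Fintype 𝓐] [Nonempty 𝓐]
    [DiscreteMeasurableSpace 𝓐] (hR : Measurable R)
    (hsub : ∀ θ a, HasSubgaussianMGF (fun y => R y - meanReward p R a θ) v (p (θ, a)))
    (hB : ∀ θ a, |meanReward p R a θ| ≤ B)
    (h : IsExpertThompsonSampling p aStar hA P₀ N P θs D θhat A Y Ystar) (T : ℕ) :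
    0 ≤ mutualInfo (aStar ∘ θs) D P ∧
    mutualInfo (aStar ∘ θs) D P ≤ entropy (aStar ∘ θs) P ∧
    Integrable (regret R Y Ystar T) P ∧
    ∫ ω, regret R Y Ystar T ω ∂P ≤ √(2 * Fintype.card 𝓐 * (v + B ^ 2)) *
      √(T * (entropy (aStar ∘ θs) P - mutualInfo (aStar ∘ θs) D P)) := by
  refine ⟨sub_nonneg.2 (condEntropy_le_entropy h.aemeasurable_optimalAction
      h.expert_law.aemeasurable_snd), sub_le_self _ (condEntropy_nonneg _ _ _),
    h.integrable_regret hR hsub hB T, ?_⟩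
  rw [mutualInfo, sub_sub_cancel, ← Real.sqrt_mul (by positivity)]
  have hbound : ∫ ω, regret R Y Ystar T ω ∂P ≤
      √(4 * (T * (Fintype.card 𝓐 * ((v + B ^ 2) / 2))) * condEntropy (aStar ∘ θs) D P) :=
    le_sqrt_of_forall_mul_le fun η => by
      have htotal := h.mul_integral_regret_le_condEntropy_sub hR hsub hB le_rfl η T
      have hfinal := condEntropy_nonneg (aStar ∘ θs) (fun ω => (D ω, history A Y T ω)) P
      linarith
  exact hbound.trans_eq (by ring_nf)

end Regret

theorem theorem1
    {Θ 𝓐 𝓨 : Type*} [MeasurableSpace Θ] [StandardBorelSpace Θ] [Nonempty Θ]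
    [Fintype 𝓐] [Nonempty 𝓐] [MeasurableSpace 𝓐] [DiscreteMeasurableSpace 𝓐]
    [MeasurableSpace 𝓨]
    (p : Kernel (Θ × 𝓐) 𝓨) [IsMarkovKernel p] (R : 𝓨 → ℝ) (hR : Measurable R)
    (v : ℝ≥0) (B : ℝ)
    (hsub : ∀ θ a, HasSubgaussianMGF (fun y => R y - meanReward p R a θ) v (p (θ, a)))
    (hB : ∀ θ a, |meanReward p R a θ| ≤ B)
    (aStar : Θ → 𝓐) (hA : Measurable aStar)
    (hopt : ∀ θ a, meanReward p R a θ ≤ meanReward p R (aStar θ) θ) :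
    ∃ C : ℝ, ∀ (P₀ : Measure Θ) [IsProbabilityMeasure P₀] (N T : ℕ)
      {Ω : Type*} [MeasurableSpace Ω] (P : Measure Ω) [IsProbabilityMeasure P]
      (θs : Ω → Θ) (D : Ω → Fin N → 𝓨) (θhat : ℕ → Ω → Θ) (A : ℕ → Ω → 𝓐)
      (Y Ystar : ℕ → Ω → 𝓨),
      IsExpertThompsonSampling p aStar hA P₀ N P θs D θhat A Y Ystar →
        0 ≤ mutualInfo (aStar ∘ θs) D P ∧
        mutualInfo (aStar ∘ θs) D P ≤ entropy (aStar ∘ θs) P ∧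
        Integrable (regret R Y Ystar T) P ∧
        ∫ ω, regret R Y Ystar T ω ∂P ≤
          C * √(T * (entropy (aStar ∘ θs) P - mutualInfo (aStar ∘ θs) D P)) :=
  ⟨_, fun _ _ _ T _ _ _ _ _ _ _ _ _ _ h => theorem1_general hR hsub hB h T⟩
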